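/- **Definitions.** For a graph $F$ and $h\colon V(F)\to\mathbb Z_{\ge 0}$, the *blow-up* $F(h)$ arises from $F$ by replacing each vertex $z$ by an independent set of size $h(z)$ (possibly empty) and each edge by a complete bipartite graph; for constant $h=p$ write $F(p)$. For $i\ge 2$ let $\Gamma_i$ be the Andrásfai graph on $\{v_0,\dots,v_{3i-2}\}$ with $v_jv_\ell$ an edge iff $i\le|j-\ell|\le 2i-1$. The Vega graph $\Upsilon_i=\Upsilon_i^{00}$ is obtained from $\Gamma_i$ by adding an edge $xy$ and an induced $6$-cycle $avcubw$, joining $x$ to $a,b,c$ and $y$ to $u,v,w$, and joining $a,u$ to $v_0,\dots,v_{i-1}$; $b,v$ to $v_i,\dots,v_{2i-1}$; and $c,w$ to $v_{2i},\dots,v_{3i-2}$. For $\mu,\nu\in\{0,1\}$, the Vega graph $\Upsilon_i^{\mu\nu}$ is obtained from $\Upsilon_i$ by deleting $y$ if $\mu=1$ and deleting $v_{2i-1}$ if $\nu=1$. Define $\omega_{00}\colon V(\Upsilon_i)\to\mathbb Z$ to be $1$ on $x,y,v_0,v_{2i-1}$; $3i-2$ on $a,b,u,v$; $3i-3$ on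 $c,w$; and $3$ on all other $v_j$. Let $f$ be $1$ on $u,v,w,y$, $-1$ on $x$, and $0$ elsewhere; let $g$ be $1$ on $b,v,v_{i-1},v_{2i-1}$, $-1$ on $v_0$, and $0$ elsewhere. Put $\omega_{\mu\nu}=\omega_{00}-\mu f-\nu g$ (which is positive on $V(\Upsilon_i^{\mu\nu})$) and $G_i^{\mu\nu}=\Upsilon_i^{\mu\nu}(\omega_{\mu\nu})$. Further let $$g_k(n,s)=\tfrac12k(k-1)n^2-k(3k-4)ns+\tfrac12(3k-4)(3k-1)s^2,\qquad \lambda=(3k-1)s-kn.$$ For $k\ge 10$ and $n\ge s\ge 1$ let $\mathscr H^n_k(s)$ be the family consisting exactly of the following graphs, where $i\ge2$ and $\mu,\nu\in\{0,1\}$: (a) if $s=\frac{kn}{3k-1}$, the graphs $G_i^{\mu\nu}(3s-n)$ with $k=9i-(6+\mu+\nu)$; (b) if $\frac{kn}{3k-1}<s\le\frac{(k-1)n}{3k-4}$, the graphs $\Upsilon_i^{0\nu}\bigl((3s-n)\omega_{0\nu}-\lambda f\bigr)$ with $k=9i-(6+\nu)$; (c) if $\frac{kn}{3k-1}<s\le\frac{(k-1)n}{3k-4}$,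 the graphs $\Upsilon_i^{\mu0}\bigl((3s-n)\omega_{\mu0}-\lambda g\bigr)$ with $k=9i-(6+\mu)$. **Lemma.** Let $i\ge 2$, $\mu,\nu\in\{0,1\}$, $n\ge s\ge 1$, and $k=9i-(6+\mu+\nu)$. Let $H$ be an $n$-vertex blow-up of $\Upsilon_i^{\mu\nu}$ with independence number $\alpha(H)\le s$ and with $e(H)=g_k(n,s)$ edges. Then $H$ is isomorphic to a graph in $\mathscr H^n_k(s)$. More precisely, $H\cong\Upsilon_i^{\mu\nu}(h)$ for some $h$ such that either $s=\frac{kn}{3k-1}$ and $h=(3s-n)\omega_{\mu\nu}$; or $\frac{kn}{3k-1}<s\le\frac{(k-1)n}{3k-4}$ and at least one of the following holds: $\mu=0$ and $h=(3s-n)\omega_{\mu\nu}-\lambda f$, or $\nu=0$ and $h=(3s-n)\omega_{\mu\nu}-\lambda g$. -/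

import Mathlib

namespace VegaExtremal

/-- The blow-up `F(h)`: every vertex `z` of `F` is replaced by an independent set of size `h z`,
and every edge of `F` by a complete bipartite graph. Empty vertex classes are allowed. -/
def blowUp {α : Type} (F : SimpleGraph α) (h : α → ℕ) : SimpleGraph (Σ z : α, Fin (h z)) :=
  F.comap Sigma.fst

/-- `H` is (up to isomorphism) a blow-up of `F`. -/
def IsBlowUp {α : Type} {V : Type*} (H : SimpleGraph V) (F : SimpleGraph α) : Prop :=
  ∃ h : α → ℕ, Nonempty (H ≃g blowUp F h)

/-- The Andrásfai graph `Γ_k` on `v_0, …, v_{3k-2}`. -/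
def andrasfai (k : ℕ) : SimpleGraph (Fin (3 * k - 1)) where
  Adj p q := k ≤ ((p : ℤ) - (q : ℤ)).natAbs ∧ ((p : ℤ) - (q : ℤ)).natAbs ≤ 2 * k - 1
  symm := ⟨fun p q h => by omega⟩
  loopless := ⟨fun p h => by have := p.isLt; omega⟩

/-- The `3i + 7` vertices of the Vega graph `Υ_i`; `inner j` is the vertex `v_j` of `Γ_i`. -/
inductive VegaVertex (i : ℕ) : Type
  | x | y | a | b | c | u | v | w
  | inner (j : Fin (3 * i - 1))
  deriving DecidableEq, Fintype

/-- The edges of `Υ_i`, each listed in at least one orientation. -/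
def vegaRel (i : ℕ) : VegaVertex i → VegaVertex i → Prop
  -- the Andrásfai graph in the middle
  | .inner p, .inner q => (andrasfai i).Adj p q
  -- the edge `xy`
  | .x, .y => True
  -- the 6-cycle `avcubw`
  | .a, .v => True
  | .v, .c => True
  | .c, .u => True
  | .u, .b => True
  | .b, .w => True
  | .w, .a => True
  -- `x` is joined to `a, b, c`, and `y` to `u, v, w`
  | .x, .a => True
  | .x, .b => True
  | .x, .c => True
  | .y, .u => True
  | .y, .v => True
  | .y, .w => True
  -- the edges between the 6-cycle and the Andrásfai graph
  | .a, .inner j => (j : ℕ) ≤ i - 1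
  | .u, .inner j => (j : ℕ) ≤ i - 1
  | .b, .inner j => i ≤ (j : ℕ) ∧ (j : ℕ) ≤ 2 * i - 1
  | .v, .inner j => i ≤ (j : ℕ) ∧ (j : ℕ) ≤ 2 * i - 1
  | .c, .inner j => 2 * i ≤ (j : ℕ)
  | .w, .inner j => 2 * i ≤ (j : ℕ)
  | _, _ => False

/-- The Vega graph `Υ_i = Υ_i^{00}` (for `i ≥ 2`). -/
def vega (i : ℕ) : SimpleGraph (VegaVertex i) :=
  SimpleGraph.fromRel (vegaRel i)

/-- The vertex set of `Υ_i^{μν}`: the vertex `y` is deleted if `μ = 1`, and the vertex `v_{2i-1}`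
is deleted if `ν = 1`. -/
def vegaVerts (i : ℕ) (μ ν : Fin 2) : Set (VegaVertex i) :=
  {z | ¬ (μ = 1 ∧ z = .y) ∧ ¬ (ν = 1 ∧ ∃ j, z = .inner j ∧ (j : ℕ) = 2 * i - 1)}

/-- The Vega graph `Υ_i^{μν}`. -/
def vegaDel (i : ℕ) (μ ν : Fin 2) : SimpleGraph (vegaVerts i μ ν) :=
  (vega i).induce (vegaVerts i μ ν)

/-- The weight function `ω_{00}`. -/
def omegaZero (i : ℕ) : VegaVertex i → ℤ
  | .x | .y => 1
  | .a | .b | .u | .v => 3 * i - 2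
  | .c | .w => 3 * i - 3
  | .inner j => if (j : ℕ) = 0 ∨ (j : ℕ) = 2 * i - 1 then 1 else 3

/-- The function `f`. -/
def f (i : ℕ) : VegaVertex i → ℤ
  | .u | .v | .w | .y => 1
  | .x => -1
  | _ => 0

/-- The function `g`. -/
def g (i : ℕ) : VegaVertex i → ℤ
  | .b | .v => 1
  | .inner j =>
      if (j : ℕ) = 0 then -1
      else if (j : ℕ) = i - 1 ∨ (j : ℕ) = 2 * i - 1 then 1
      else 0
  | _ => 0

/-- The weight function `ω_{μν} = ω_{00} - μ f - ν g`. -/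
def omega (i : ℕ) (μ ν : Fin 2) (z : VegaVertex i) : ℤ :=
  omegaZero i z - ((μ : ℕ) : ℤ) * f i z - ((ν : ℕ) : ℤ) * g i z

/-- The graph `G_i^{μν} = Υ_i^{μν}(ω_{μν})`; for `i ≥ 2` the weight `ω_{μν}` is positive on the
vertices of `Υ_i^{μν}`. -/
def vegaRegular (i : ℕ) (μ ν : Fin 2) :
    SimpleGraph (Σ z : vegaVerts i μ ν, Fin (omega i μ ν z).toNat) :=
  blowUp (vegaDel i μ ν) fun z => (omega i μ ν z).toNat

/-- The quadratic function `g_k(n, s)`. -/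
def edgeBound (k n s : ℕ) : ℚ :=
  (k : ℚ) * (k - 1) * n ^ 2 / 2 - k * (3 * k - 4) * n * s + (3 * k - 4) * (3 * k - 1) * s ^ 2 / 2

/-- The number `λ = (3k-1)s - kn`. -/
def lam (k n s : ℕ) : ℤ := (3 * (k : ℤ) - 1) * s - k * n

/-- The family `ℋ^n_k(s)`, the smallest collection of graphs with the three closure properties.
In the first constructor `n ≤ 3s`, so that the natural subtraction `3s - n` is the true one. -/
inductive ExtremalFamily (n k s : ℕ) : (W : Type) → SimpleGraph W → Prop
  | balanced (i : ℕ) (μ ν : Fin 2) (hi : 2 ≤ i) (hk : k = 9 * i - (6 + (μ : ℕ) + (ν : ℕ)))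
      (hs : (s : ℚ) = k * n / (3 * k - 1)) :
      ExtremalFamily n k s _ (blowUp (vegaRegular i μ ν) fun _ => 3 * s - n)
  | alongF (i : ℕ) (ν : Fin 2) (hi : 2 ≤ i) (hk : k = 9 * i - (6 + (ν : ℕ)))
      (hs : (k : ℚ) * n / (3 * k - 1) < s) (hs' : (s : ℚ) ≤ (k - 1) * n / (3 * k - 4))
      (h : vegaVerts i 0 ν → ℕ)
      (hh : ∀ z, (h z : ℤ) = (3 * (s : ℤ) - n) * omega i 0 ν z - lam k n s * f i z) :
      ExtremalFamily n k s _ (blowUp (vegaDel i 0 ν) h)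
  | alongG (i : ℕ) (μ : Fin 2) (hi : 2 ≤ i) (hk : k = 9 * i - (6 + (μ : ℕ)))
      (hs : (k : ℚ) * n / (3 * k - 1) < s) (hs' : (s : ℚ) ≤ (k - 1) * n / (3 * k - 4))
      (h : vegaVerts i μ 0 → ℕ)
      (hh : ∀ z, (h z : ℤ) = (3 * (s : ℤ) - n) * omega i μ 0 z - lam k n s * g i z) :
      ExtremalFamily n k s _ (blowUp (vegaDel i μ 0) h)

end VegaExtremal

/-!
Let `A` be the adjacency matrix of `Υ_i^{μν}` and `w = ω_{μν}`, so that `A w = k 𝟙`. There is an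
explicit symmetric integer matrix `C` with `A C = I + 𝟙 wᵀ`, and deleting a vertex from the graph
changes `C` by a Schur complement. If `h` are the class sizes of `H` and `d = s 𝟙 - A h`, then
`d ≥ 0` because neighbourhoods in the triangle-free graph `H` are independent, and
`h = (3s - n) w - C d`. The number of edges is `g_k(n, s)` precisely when `dᵀ C d = (wᵀ d)²`. Now
`C ≤ w wᵀ` entrywise, with equality only in the diagonal entries at vertices of weight one. Hence
`d` vanishes or is concentrated on one such vertex `z`, and `h = (3s - n) w - λ C_z`. The vertices
of weight one are among `x, y, v_0, v_{2i-1}`. Here `C_y = f` and `C_{v_{2i-1}} = g`, and two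
automorphisms of the Vega graph map `x` to `y` and `v_0` to `v_{2i-1}`.
-/

namespace VegaExtremal

open Finset Matrix

section WeightedInverse

variable {ι R : Type*} [Fintype ι] [CommRing R]

theorem dotProduct_eq_of_eqOn {S : Set ι} {h v v' : ι → R} (hh : ∀ z ∉ S, h z = 0)
    (hv : Set.EqOn v v' S) : h ⬝ᵥ v = h ⬝ᵥ v' := by
  refine sum_congr rfl fun z _ => ?_
  by_cases hz : z ∈ S
  · rw [hv hz]
  · rw [hh z hz, zero_mul, zero_mul]

/-- `C` inverts the symmetric matrix `A` on the index set `S` up to constants, `A C = I + 𝟙 wᵀ` on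
the rows in `S`, where `w` is a weighting of `S` with `A w = k 𝟙` on `S` and total weight `3k - 1`.
Both `w` and `C` are extended by zero outside `S`, so that indices can be deleted from `S` without
changing the index type. -/
structure IsWeightedInverse [DecidableEq ι] (A : Matrix ι ι R) (S : Set ι) (k : R) (w : ι → R)
    (C : Matrix ι ι R) : Prop where
  isSymm_left : A.IsSymm
  isSymm : C.IsSymm
  weight_of_notMem : ∀ z ∉ S, w z = 0
  apply_of_notMem : ∀ z ∉ S, ∀ t, C z t = 0
  sum_weight : ∑ z, w z = 3 * k - 1
  mulVec_weight : ∀ z ∈ S, (A *ᵥ w) z = k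
  mul_apply : ∀ z ∈ S, ∀ t, (A * C) z t = (1 : Matrix ι ι R) z t + w t

/-- How far the `A`-weighted sums of `h` fall short of `s` on `S`. For an adjacency matrix `A` these
are the weights of the neighbourhoods. -/
noncomputable def defect (A : Matrix ι ι R) (S : Set ι) (s : R) (h : ι → R) : ι → R :=
  S.indicator fun z => s - (A *ᵥ h) z

theorem dotProduct_defect {A : Matrix ι ι R} {S : Set ι} {g h : ι → R} (hg : ∀ z ∉ S, g z = 0)
    (s : R) : g ⬝ᵥ defect A S s h = s * ∑ z, g z - g ⬝ᵥ A *ᵥ h :=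
  calc g ⬝ᵥ defect A S s h = g ⬝ᵥ (s • 1 - A *ᵥ h) :=
        dotProduct_eq_of_eqOn hg fun z hz => by simp [defect, hz]
    _ = s * ∑ z, g z - g ⬝ᵥ A *ᵥ h := by
        rw [dotProduct_sub, dotProduct_smul, dotProduct_one, smul_eq_mul]

namespace IsWeightedInverse

variable [DecidableEq ι] {A C : Matrix ι ι R} {S : Set ι} {k : R} {w : ι → R}

theorem mul_apply_right (hC : IsWeightedInverse A S k w C) {t : ι} (ht : t ∈ S) (z : ι) :
    (C * A) z t = (1 : Matrix ι ι R) z t + w z := by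
  rw [← transpose_apply (C * A), transpose_mul, hC.isSymm_left.eq, hC.isSymm.eq,
    hC.mul_apply t ht, ← transpose_apply 1, transpose_one]

theorem mulVec_mulVec (hC : IsWeightedInverse A S k w C) {h : ι → R} (hh : ∀ z ∉ S, h z = 0) :
    C *ᵥ (A *ᵥ h) = h + (∑ z, h z) • w := by
  ext z
  calc (C *ᵥ (A *ᵥ h)) z = h ⬝ᵥ (C * A) z := by
        rw [Matrix.mulVec_mulVec, mulVec, dotProduct_comm]
    _ = h ⬝ᵥ ((1 : Matrix ι ι R) z + w z • 1) :=
        dotProduct_eq_of_eqOn hh fun t ht => by simp [hC.mul_apply_right ht]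
    _ = (h + (∑ z, h z) • w) z := by
        rw [dotProduct_add, dotProduct_smul, dotProduct_one, dotProduct_comm h, ← mulVec,
          one_mulVec, Pi.add_apply, Pi.smul_apply, smul_eq_mul, smul_eq_mul, mul_comm]

theorem mulVec_one [IsDomain R] (hC : IsWeightedInverse A S k w C) (hk : k ≠ 0) :
    C *ᵥ 1 = (3 : R) • w := by
  ext z
  refine mul_left_cancel₀ hk ?_
  calc k * (C *ᵥ 1) z = (C *ᵥ (k • 1)) z := by rw [mulVec_smul, Pi.smul_apply, smul_eq_mul]
    _ = (C *ᵥ (A *ᵥ w)) z :=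
        dotProduct_eq_of_eqOn (S := S)
          (fun t ht => by rw [← hC.isSymm.apply, hC.apply_of_notMem t ht])
          fun t ht => by simp [hC.mulVec_weight t ht]
    _ = k * ((3 : R) • w) z := by
        rw [hC.mulVec_mulVec hC.weight_of_notMem, hC.sum_weight]
        simp only [Pi.add_apply, Pi.smul_apply, smul_eq_mul]
        ring

theorem eq_sub_mulVec_defect [IsDomain R] (hC : IsWeightedInverse A S k w C) (hk : k ≠ 0)
    {h : ι → R} (hh : ∀ z ∉ S, h z = 0) (s : R) :
    h = (3 * s - ∑ z, h z) • w - C *ᵥ defect A S s h := by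
  ext z
  have hz : (C *ᵥ defect A S s h) z = s * (C *ᵥ 1) z - (C *ᵥ (A *ᵥ h)) z := by
    rw [mulVec, dotProduct_defect fun t ht => by
      rw [← hC.isSymm.apply, hC.apply_of_notMem t ht], ← dotProduct_one]
    rfl
  simp only [Pi.sub_apply, Pi.smul_apply, smul_eq_mul, hz, hC.mulVec_one hk, hC.mulVec_mulVec hh,
    Pi.add_apply]
  ring

theorem weight_dotProduct_defect (hC : IsWeightedInverse A S k w C) {h : ι → R}
    (hh : ∀ z ∉ S, h z = 0) (s : R) :
    w ⬝ᵥ defect A S s h = (3 * k - 1) * s - k * ∑ z, h z := by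
  have hwh : w ⬝ᵥ A *ᵥ h = k * ∑ z, h z :=
    calc w ⬝ᵥ A *ᵥ h = h ⬝ᵥ A *ᵥ w := by
          rw [← dotProduct_transpose_mulVec, hC.isSymm_left.eq]
      _ = h ⬝ᵥ (k • 1) := dotProduct_eq_of_eqOn hh fun z hz => by simp [hC.mulVec_weight z hz]
      _ = k * ∑ z, h z := by rw [dotProduct_smul, dotProduct_one, smul_eq_mul]
  rw [dotProduct_defect hC.weight_of_notMem, hC.sum_weight, hwh, mul_comm]

theorem mulVec_row (hC : IsWeightedInverse A S k w C) {y z : ι} (hz : z ∈ S \ {y})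
    (hw : w y = 1) : (A *ᵥ C y) z = 1 :=
  calc (A *ᵥ C y) z = (A * C) z y := by
        rw [mulVec, dotProduct, Matrix.mul_apply]
        simp only [hC.isSymm.apply]
    _ = 1 := by rw [hC.mul_apply z hz.1, one_apply_ne hz.2, hw, zero_add]

/-- Deleting `y` is a Schur complement: it subtracts from `C` the rank-one matrix of its row `y`. -/
theorem erase [IsDomain R] (hC : IsWeightedInverse A S k w C) (hk : k ≠ 0) {y : ι}
    (hw : w y = 1) (hCy : C y y = 1) :
    IsWeightedInverse A (S \ {y}) (k - 1) (w - C y) (C - vecMulVec (C y) (C y)) where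
  isSymm_left := hC.isSymm_left
  isSymm := hC.isSymm.sub (transpose_vecMulVec _ _)
  weight_of_notMem z hz := by
    by_cases hzS : z ∈ S
    · obtain rfl : z = y := by_contra fun hne => hz ⟨hzS, hne⟩
      rw [Pi.sub_apply, hw, hCy, sub_self]
    · rw [Pi.sub_apply, hC.weight_of_notMem z hzS, ← hC.isSymm.apply, hC.apply_of_notMem z hzS,
        sub_self]
  apply_of_notMem z hz t := by
    by_cases hzS : z ∈ S
    · obtain rfl : z = y := by_contra fun hne => hz ⟨hzS, hne⟩
      rw [Matrix.sub_apply, vecMulVec_apply, hCy, one_mul, sub_self]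
    · rw [Matrix.sub_apply, vecMulVec_apply, hC.isSymm.apply z y, hC.apply_of_notMem z hzS,
        hC.apply_of_notMem z hzS, zero_mul, sub_self]
  sum_weight := by
    have hrow : ∑ z, C y z = 3 := by
      simpa [mulVec, dotProduct_one, hw] using congrFun (hC.mulVec_one hk) y
    simp only [Pi.sub_apply, sum_sub_distrib, hC.sum_weight, hrow]
    ring
  mulVec_weight z hz := by
    rw [mulVec_sub, Pi.sub_apply, hC.mulVec_weight z hz.1, hC.mulVec_row hz hw]
  mul_apply z hz t := by
    rw [Matrix.mul_sub, Matrix.sub_apply, mul_vecMulVec, vecMulVec_apply, hC.mulVec_row hz hw,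
      hC.mul_apply z hz.1, one_mul, Pi.sub_apply, add_sub_assoc]

end IsWeightedInverse

end WeightedInverse

section Domination

variable {ι R : Type*} [Fintype ι] [CommRing R] [LinearOrder R] [IsStrictOrderedRing R]
  {C : Matrix ι ι R} {S : Set ι} {w d : ι → R}

theorem mul_eq_zero_of_dotProduct_mulVec_eq_sq (hd : 0 ≤ d) (hdS : ∀ z ∉ S, d z = 0)
    (hle : ∀ z ∈ S, ∀ t ∈ S, C z t ≤ w z * w t) (hsq : d ⬝ᵥ C *ᵥ d = (w ⬝ᵥ d) ^ 2)
    {z t : ι} (hlt : C z t < w z * w t) : d z * d t = 0 := by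
  have hsum : ∑ z, ∑ t, (w z * w t - C z t) * (d z * d t) = 0 := by
    rw [← sub_eq_zero.2 hsq.symm, sq]
    simp only [dotProduct, mulVec]
    rw [sum_mul_sum]
    simp only [mul_sum, ← sum_sub_distrib]
    exact sum_congr rfl fun z _ => sum_congr rfl fun t _ => by ring
  have hterm (z t : ι) : 0 ≤ (w z * w t - C z t) * (d z * d t) := by
    by_cases hz : z ∈ S
    · by_cases ht : t ∈ S
      · exact mul_nonneg (sub_nonneg.2 (hle z hz t ht)) (mul_nonneg (hd z) (hd t))
      · rw [hdS t ht, mul_zero, mul_zero]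
    · rw [hdS z hz, zero_mul, mul_zero]
  have hrow : ∑ t, (w z * w t - C z t) * (d z * d t) = 0 :=
    (sum_eq_zero_iff_of_nonneg fun z _ => sum_nonneg fun t _ => hterm z t).1 hsum z (mem_univ z)
  have hzt : (w z * w t - C z t) * (d z * d t) = 0 :=
    (sum_eq_zero_iff_of_nonneg fun t _ => hterm z t).1 hrow t (mem_univ t)
  exact (mul_eq_zero.1 hzt).resolve_left (sub_pos.2 hlt).ne'

theorem eq_zero_or_eq_single_of_dotProduct_mulVec_eq_sq [DecidableEq ι] (hd : 0 ≤ d)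
    (hdS : ∀ z ∉ S, d z = 0) (hle : ∀ z ∈ S, ∀ t ∈ S, C z t ≤ w z * w t)
    (heq : ∀ z ∈ S, ∀ t ∈ S, C z t = w z * w t → z = t ∧ w z = 1)
    (hsq : d ⬝ᵥ C *ᵥ d = (w ⬝ᵥ d) ^ 2) :
    d = 0 ∨ ∃ z ∈ S, w z = 1 ∧ 0 < w ⬝ᵥ d ∧ d = Pi.single z (w ⬝ᵥ d) := by
  refine or_iff_not_imp_left.2 fun hd0 => ?_
  obtain ⟨z, hdz⟩ := Function.ne_iff.1 hd0
  have hz : z ∈ S := by_contra fun hz => hdz (hdS z hz)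
  have hattained (t : ι) (hdt : d t ≠ 0) : z = t ∧ w z = 1 := by
    have ht : t ∈ S := by_contra fun ht => hdt (hdS t ht)
    refine heq z hz t ht ((hle z hz t ht).antisymm (not_lt.1 fun hlt => ?_))
    exact mul_ne_zero hdz hdt (mul_eq_zero_of_dotProduct_mulVec_eq_sq hd hdS hle hsq hlt)
  have hwz : w z = 1 := (hattained z hdz).2
  have hsingle : d = Pi.single z (d z) := by
    ext t
    rcases eq_or_ne t z with rfl | htz
    · rw [Pi.single_eq_same]
    · rw [Pi.single_eq_of_ne htz]
      exact by_contra fun hdt => htz (hattained t hdt).1.symm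
  have hwd : w ⬝ᵥ d = d z := by rw [hsingle, dotProduct_single, hwz, one_mul, Pi.single_eq_same]
  exact ⟨z, hz, hwz, hwd ▸ (hd z).lt_of_ne' hdz, hwd ▸ hsingle⟩

variable [DecidableEq ι] {A : Matrix ι ι R} {k : R} {h : ι → R}

theorem IsWeightedInverse.eq_of_dotProduct_mulVec_eq (hC : IsWeightedInverse A S k w C)
    (hk : k ≠ 0) (hle : ∀ z ∈ S, ∀ t ∈ S, C z t ≤ w z * w t)
    (heq : ∀ z ∈ S, ∀ t ∈ S, C z t = w z * w t → z = t ∧ w z = 1) (hh : 0 ≤ h)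
    (hhS : ∀ z ∉ S, h z = 0) {n s l : R} (hs : ∀ z ∈ S, (A *ᵥ h) z ≤ s) (hn : ∑ z, h z = n)
    (hl : (3 * k - 1) * s - k * n = l) (hA : h ⬝ᵥ A *ᵥ h = n * s - l * (3 * s - n - l)) :
    (l = 0 ∧ h = (3 * s - n) • w) ∨
      (0 < l ∧ l ≤ 3 * s - n ∧ ∃ z ∈ S, w z = 1 ∧ h = (3 * s - n) • w - l • C z) := by
  have hd : 0 ≤ defect A S s h := Set.indicator_nonneg fun z hz => sub_nonneg.2 (hs z hz)
  have hdS (z : ι) (hz : z ∉ S) : defect A S s h z = 0 := Set.indicator_of_notMem hz _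
  have hwd : w ⬝ᵥ defect A S s h = l := by rw [hC.weight_dotProduct_defect hhS, hn, hl]
  have hhd : h ⬝ᵥ defect A S s h = l * (3 * s - n - l) := by
    rw [dotProduct_defect hhS, hn, hA]; ring
  have hrep : h = (3 * s - n) • w - C *ᵥ defect A S s h := hn ▸ hC.eq_sub_mulVec_defect hk hhS s
  generalize defect A S s h = d at hd hdS hwd hhd hrep
  have hsq : d ⬝ᵥ C *ᵥ d = (w ⬝ᵥ d) ^ 2 := by
    have hdh := congrArg (d ⬝ᵥ ·) hrep
    simp only [dotProduct_sub, dotProduct_smul, dotProduct_comm d h, dotProduct_comm d w, hwd, hhd,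
      smul_eq_mul] at hdh
    rw [hwd]
    linear_combination hdh
  rcases eq_zero_or_eq_single_of_dotProduct_mulVec_eq_sq hd hdS hle heq hsq with
    rfl | ⟨z, hz, hwz, hpos, hdz⟩
  · rw [dotProduct_zero] at hwd
    rw [mulVec_zero, sub_zero] at hrep
    exact .inl ⟨hwd.symm, hrep⟩
  · rw [hwd] at hpos hdz
    have hl_le : 0 ≤ 3 * s - n - l :=
      nonneg_of_mul_nonneg_right (hhd ▸ dotProduct_nonneg_of_nonneg hh hd) hpos
    refine .inr ⟨hpos, sub_nonneg.1 hl_le, z, hz, hwz, hrep.trans ?_⟩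
    rw [hdz, mulVec_single, op_smul_eq_smul]
    congr 2
    exact funext (hC.isSymm.apply z)

end Domination

section BlowUp

variable {α : Type*} [Fintype α] [DecidableEq α] {V : Type*} [Fintype V]

/-- The size of the class `c ⁻¹' {z}`, as an integer. -/
def classSize (c : V → α) (z : α) : ℤ :=
  #{v | c v = z}

theorem classSize_dotProduct (c : V → α) (F : α → ℤ) : classSize c ⬝ᵥ F = ∑ v, F (c v) := by
  rw [← sum_fiberwise univ c]
  refine sum_congr rfl fun z _ => ?_
  rw [sum_congr rfl fun v hv => congrArg F (mem_filter.1 hv).2, sum_const, nsmul_eq_mul, classSize]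

theorem sum_classSize (c : V → α) : ∑ z, classSize c z = Fintype.card V := by
  rw [← dotProduct_one, classSize_dotProduct]
  simp

variable (F : SimpleGraph α) [DecidableRel F.Adj] (c : V → α)

theorem card_filter_adj_eq_adjMatrix_mulVec_classSize (z : α) :
    (#{v | F.Adj z (c v)} : ℤ) = (F.adjMatrix ℤ *ᵥ classSize c) z := by
  rw [mulVec, dotProduct_comm, classSize_dotProduct]
  simp [SimpleGraph.adjMatrix_apply]

theorem two_mul_card_edgeFinset_comap [Fintype (F.comap c).edgeSet] :
    2 * (#(F.comap c).edgeFinset : ℤ) = classSize c ⬝ᵥ F.adjMatrix ℤ *ᵥ classSize c := by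
  classical
  have hdegree (v : V) : ((F.comap c).degree v : ℤ) = (F.adjMatrix ℤ *ᵥ classSize c) (c v) := by
    rw [← card_filter_adj_eq_adjMatrix_mulVec_classSize,
      ← SimpleGraph.card_neighborFinset_eq_degree, SimpleGraph.neighborFinset_eq_filter]
    simp only [SimpleGraph.comap_adj]
  rw [classSize_dotProduct, ← sum_congr rfl fun v _ => hdegree v]
  have hsum : ∑ v, (F.comap c).degree v = 2 * #(F.comap c).edgeFinset := by
    convert (F.comap c).sum_degrees_eq_twice_card_edges
  exact_mod_cast hsum.symm

theorem adjMatrix_mulVec_classSize_le_indepNum (hF : F.CliqueFree 3) (z : α) :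
    (F.adjMatrix ℤ *ᵥ classSize c) z ≤ (F.comap c).indepNum := by
  rw [← card_filter_adj_eq_adjMatrix_mulVec_classSize]
  refine Int.ofNat_le.2 (SimpleGraph.IsIndepSet.card_le_indepNum fun v hv w hw _ hvw => ?_)
  simp only [coe_filter, mem_univ, true_and, Set.mem_ofPred_eq] at hv hw
  exact SimpleGraph.isIndepSet_neighborSet_of_triangleFree F hF z hv hw
    (SimpleGraph.comap_adj.1 hvw).ne hvw

end BlowUp

section BlowUpIso

variable {α β : Type} {F : SimpleGraph α} {F' : SimpleGraph β}

theorem exists_eq_comap_of_iso_blowUp_induce [DecidableEq α] {V : Type*} [Fintype V]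
    {H : SimpleGraph V} {S : Set α} {h : S → ℕ} (e : H ≃g blowUp (F.induce S) h) :
    ∃ c : V → α, H = F.comap c ∧ (∀ z : S, classSize c z = h z) ∧ ∀ z ∉ S, classSize c z = 0 := by
  refine ⟨fun v => (e v).1, ?_, fun z => ?_, fun z hz => ?_⟩
  · ext v w
    exact e.map_rel_iff.symm
  · have hfiber : {v : V // ((e v).1 : α) = z} ≃ Fin (h z) :=
      (e.toEquiv.subtypeEquiv fun v => Subtype.ext_iff.symm).trans (Equiv.sigmaSubtype z)
    rw [classSize, ← Fintype.card_subtype, Fintype.card_congr hfiber, Fintype.card_fin]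
  · rw [classSize, Nat.cast_eq_zero, card_eq_zero, filter_eq_empty_iff]
    rintro v - rfl
    exact hz (e v).1.2

/-- The isomorphism of blow-ups induced by a graph isomorphism that respects the class sizes. -/
def blowUpCongr {h : α → ℕ} {h' : β → ℕ} (σ : F ≃g F') (hh : ∀ z, h z = h' (σ z)) :
    blowUp F h ≃g blowUp F' h' where
  toEquiv := Equiv.sigmaCongr σ.toEquiv fun z => finCongr (hh z)
  map_rel_iff' {p q} := σ.map_rel_iff (a := p.1) (b := q.1)

theorem exists_iso_blowUp_induce_of_comp {V : Type*} {H : SimpleGraph V} {S : Set α} {T : Set β}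
    (σ : F ≃g F') (hσ : Set.BijOn σ S T) {h : S → ℕ} (e : H ≃g blowUp (F.induce S) h)
    {w : β → ℤ} (hw : ∀ z : S, (h z : ℤ) = w (σ z)) :
    ∃ h' : T → ℕ, Nonempty (H ≃g blowUp (F'.induce T) h') ∧ ∀ z : T, (h' z : ℤ) = w z := by
  let τ : F.induce S ≃g F'.induce T := σ.induce hσ
  refine ⟨h ∘ τ.symm, ⟨e.trans (blowUpCongr τ fun z => ?_)⟩, fun z => ?_⟩
  · rw [Function.comp_apply, τ.symm_apply_apply]
  · calc (h (τ.symm z) : ℤ) = w (τ (τ.symm z)) := hw _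
      _ = w z := by rw [τ.apply_symm_apply]

/-- The blow-up by a constant `m` of a blow-up is a blow-up whose class sizes are `m` times as
large. -/
def blowUpBlowUp {w h : α → ℕ} {m : ℕ} (hh : ∀ z, h z = w z * m) :
    blowUp F h ≃g blowUp (blowUp F w) fun _ => m where
  toEquiv := ((Equiv.sigmaAssoc _).trans (Equiv.sigmaCongrRight fun z =>
    (Equiv.sigmaEquivProd _ _).trans (finProdFinEquiv.trans (finCongr (hh z).symm)))).symm
  map_rel_iff' := Iff.rfl

end BlowUpIso

section Vega

variable {i : ℕ}

noncomputable instance : DecidableRel (vega i).Adj := Classical.decRel _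

theorem sum_vegaVertex {M : Type*} [AddCommMonoid M] (F : VegaVertex i → M) :
    ∑ z, F z = F .x + F .y + F .a + F .b + F .c + F .u + F .v + F .w + ∑ j, F (.inner j) := by
  have huniv : (univ : Finset (VegaVertex i)) =
      {.x, .y, .a, .b, .c, .u, .v, .w} ∪ univ.image .inner := by
    ext z; cases z <;> simp
  rw [huniv, sum_union, sum_image fun p _ q _ h => VegaVertex.inner.inj h]
  · simp [add_assoc]
  · simp [disjoint_left]

theorem vega_adj {z t : VegaVertex i} :
    (vega i).Adj z t ↔ z ≠ t ∧ (vegaRel i z t ∨ vegaRel i t z) :=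
  SimpleGraph.fromRel_adj _ _ _

theorem vega_adj_inner {p q : Fin (3 * i - 1)} :
    (vega i).Adj (.inner p) (.inner q) ↔
      i ≤ ((p : ℤ) - (q : ℤ)).natAbs ∧ ((p : ℤ) - (q : ℤ)).natAbs ≤ 2 * i - 1 := by
  change _ ↔ (andrasfai i).Adj p q
  simp only [vega_adj, vegaRel, (andrasfai i).adj_comm q p, or_self, ne_eq,
    VegaVertex.inner.injEq, and_iff_right_iff_imp]
  exact fun h => h.ne

theorem vega_cliqueFree_three (hi : 2 ≤ i) : (vega i).CliqueFree 3 := by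
  intro s hs
  obtain ⟨z, p, q, hzp, hzq, hpq, -⟩ := SimpleGraph.is3Clique_iff.1 hs
  simp only [vega_adj] at hzp hzq hpq
  cases z <;> cases p <;>
    simp only [vegaRel, andrasfai, ne_eq, reduceCtorEq, not_false_eq_true, true_and, or_false,
      false_or, or_true, not_true_eq_false, or_self, and_false] at hzp <;>
    cases q <;>
    simp only [vegaRel, andrasfai, ne_eq, reduceCtorEq, not_false_eq_true, true_and, or_false,
      false_or, or_true, not_true_eq_false, or_self, and_false] at hzq hpq <;>
    omega

/-- The sum of `F` over the neighbours of a vertex of `Υ_i` outside `Γ_i`. -/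
def outerNbrSum (F : VegaVertex i → ℤ) : VegaVertex i → ℤ
  | .x => F .y + F .a + F .b + F .c
  | .y => F .x + F .u + F .v + F .w
  | .a => F .x + F .v + F .w
  | .u => F .y + F .b + F .c
  | .b => F .x + F .u + F .w
  | .v => F .y + F .a + F .c
  | .c => F .x + F .u + F .v
  | .w => F .y + F .a + F .b
  | .inner l =>
      if (l : ℕ) ≤ i - 1 then F .a + F .u
      else if (l : ℕ) ≤ 2 * i - 1 then F .b + F .v
      else F .c + F .w

/-- The entries of the adjacency matrix of `Υ_i` in the columns of `Γ_i`. The column `v_j` is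
indexed by the natural number `j`. -/
def innerAdj : VegaVertex i → ℕ → ℤ
  | .x, _ | .y, _ => 0
  | .a, j | .u, j => if j ≤ i - 1 then 1 else 0
  | .b, j | .v, j => if i ≤ j ∧ j ≤ 2 * i - 1 then 1 else 0
  | .c, j | .w, j => if 2 * i ≤ j then 1 else 0
  | .inner l, j =>
      if i ≤ ((l : ℤ) - (j : ℤ)).natAbs ∧ ((l : ℤ) - (j : ℤ)).natAbs ≤ 2 * i - 1 then 1 else 0

/-- The number of neighbours of a vertex of `Υ_i` in `Γ_i`. -/
def innerDegree : VegaVertex i → ℤ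
  | .x | .y => 0
  | .c | .w => i - 1
  | .a | .b | .u | .v | .inner _ => i

theorem adjMatrix_vega_inner (z : VegaVertex i) (j : Fin (3 * i - 1)) :
    (vega i).adjMatrix ℤ z (.inner j) = innerAdj z j := by
  rw [SimpleGraph.adjMatrix_apply]
  cases z with
  | inner l => exact if_congr vega_adj_inner rfl rfl
  | _ => simp [vega_adj, vegaRel, innerAdj]

theorem adjMatrix_vega_mulVec (F : VegaVertex i → ℤ) (z : VegaVertex i) :
    ((vega i).adjMatrix ℤ *ᵥ F) z =
      outerNbrSum F z + (fun j : Fin (3 * i - 1) => innerAdj z j) ⬝ᵥ (F ∘ .inner) := by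
  rw [mulVec, dotProduct, sum_vegaVertex]
  simp only [adjMatrix_vega_inner]
  refine congrArg₂ _ ?_ rfl
  simp only [SimpleGraph.adjMatrix_apply]
  cases z with
  | inner l =>
    have := l.isLt
    simp only [vega_adj, vegaRel, outerNbrSum, or_false, false_or, ne_eq, reduceCtorEq,
      not_false_eq_true, true_and, and_false, if_false, ite_mul, one_mul, zero_mul, zero_add]
    split_ifs <;> omega
  | _ => simp [vega_adj, vegaRel, outerNbrSum]

theorem sum_ite_eq_card {m : ℕ} (P : ℕ → Prop) [DecidablePred P] (S : Finset ℕ)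
    (hS : ∀ j, j ∈ S ↔ j < m ∧ P j) : (∑ j : Fin m, if P j then (1 : ℤ) else 0) = #S := by
  rw [Fin.sum_univ_eq_sum_range (fun j => if P j then (1 : ℤ) else 0), sum_boole]
  congr 2
  ext j
  rw [mem_filter, mem_range, hS]

theorem sum_innerAdj (hi : 2 ≤ i) (z : VegaVertex i) :
    ∑ j : Fin (3 * i - 1), innerAdj z j = innerDegree z := by
  cases z with
  | x | y => simp only [innerAdj, innerDegree, sum_const_zero]
  | a | u =>
    refine (sum_ite_eq_card (fun j => j ≤ i - 1) (Ico 0 i) fun j => ?_).trans ?_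
    · rw [mem_Ico]; omega
    · rw [Nat.card_Ico, innerDegree]; omega
  | b | v =>
    refine (sum_ite_eq_card (fun j => i ≤ j ∧ j ≤ 2 * i - 1) (Ico i (2 * i)) fun j => ?_).trans ?_
    · rw [mem_Ico]; omega
    · rw [Nat.card_Ico, innerDegree]; omega
  | c | w =>
    refine (sum_ite_eq_card (fun j => 2 * i ≤ j) (Ico (2 * i) (3 * i - 1)) fun j => ?_).trans ?_
    · rw [mem_Ico]; omega
    · rw [Nat.card_Ico, innerDegree]; omega
  | inner l =>
    obtain ⟨l, hl⟩ := l
    have hdisj : Disjoint (Ico (l + 1 - 2 * i) (l + 1 - i))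
        (Ico (l + i) (min (l + 2 * i) (3 * i - 1))) := by
      rw [disjoint_left]; intro j; rw [mem_Ico, mem_Ico]; omega
    refine (sum_ite_eq_card (fun j => i ≤ ((l : ℤ) - (j : ℤ)).natAbs ∧
      ((l : ℤ) - (j : ℤ)).natAbs ≤ 2 * i - 1) _ fun j => ?_).trans
      (congrArg Nat.cast (card_union_of_disjoint hdisj) |>.trans ?_)
    · rw [mem_union, mem_Ico, mem_Ico]; omega
    · rw [Nat.card_Ico, Nat.card_Ico, innerDegree]; omega

theorem innerAdj_zero (hi : 2 ≤ i) (z : VegaVertex i) : innerAdj z 0 = match z with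
    | .a | .u => 1
    | .inner l => if i ≤ (l : ℕ) ∧ (l : ℕ) ≤ 2 * i - 1 then 1 else 0
    | _ => 0 := by
  cases z <;> simp only [innerAdj] <;> split_ifs <;> omega

theorem innerAdj_mid (hi : 2 ≤ i) (z : VegaVertex i) : innerAdj z (2 * i - 1) = match z with
    | .b | .v => 1
    | .inner l => if (l : ℕ) ≤ i - 1 then 1 else 0
    | _ => 0 := by
  cases z with
  | inner l => have := l.isLt; simp only [innerAdj]; split_ifs <;> omega
  | _ => simp only [innerAdj] <;> split_ifs <;> omega

theorem dotProduct_comp_inner_of_eq (hi : 2 ≤ i) {F : VegaVertex i → ℤ} {c α β : ℤ}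
    (hF : ∀ j, F (.inner j) =
      c - (if (j : ℕ) = 0 then α else 0) - (if (j : ℕ) = 2 * i - 1 then β else 0))
    (r : Fin (3 * i - 1) → ℤ) :
    r ⬝ᵥ (F ∘ .inner) =
      c * (∑ j, r j) - α * r ⟨0, by omega⟩ - β * r ⟨2 * i - 1, by omega⟩ := by
  have hF' : F ∘ .inner = c • 1 - α • Pi.single ⟨0, by omega⟩ 1
      - β • Pi.single ⟨2 * i - 1, by omega⟩ 1 := by
    ext j
    simp [hF, Pi.single_apply, Fin.ext_iff]
  simp only [hF', dotProduct_sub, dotProduct_smul, dotProduct_one, dotProduct_single_one,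
    smul_eq_mul]

theorem adjMatrix_vega_mulVec_of_inner_eq (hi : 2 ≤ i) {F : VegaVertex i → ℤ} {c α β : ℤ}
    (hF : ∀ j, F (.inner j) =
      c - (if (j : ℕ) = 0 then α else 0) - (if (j : ℕ) = 2 * i - 1 then β else 0))
    (z : VegaVertex i) : ((vega i).adjMatrix ℤ *ᵥ F) z =
      outerNbrSum F z + (c * innerDegree z - α * innerAdj z 0 - β * innerAdj z (2 * i - 1)) := by
  rw [adjMatrix_vega_mulVec, dotProduct_comp_inner_of_eq hi hF, sum_innerAdj hi]

theorem omegaZero_inner (j : Fin (3 * i - 1)) : omegaZero i (.inner j) =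
    3 - (if (j : ℕ) = 0 then 2 else 0) - (if (j : ℕ) = 2 * i - 1 then 2 else 0) := by
  have := j.isLt
  simp only [omegaZero]
  split_ifs <;> omega

theorem adjMatrix_vega_mulVec_omegaZero (hi : 2 ≤ i) (z : VegaVertex i) :
    ((vega i).adjMatrix ℤ *ᵥ omegaZero i) z = 9 * i - 6 := by
  rw [adjMatrix_vega_mulVec_of_inner_eq hi omegaZero_inner]
  cases z <;> simp only [outerNbrSum, omegaZero, innerDegree, innerAdj_zero hi, innerAdj_mid hi] <;>
    (try split_ifs) <;> omega

theorem sum_omegaZero (hi : 2 ≤ i) : ∑ z, omegaZero i z = 27 * i - 19 := by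
  have hinner : ∑ j, omegaZero i (.inner j) = 3 * (3 * i - 1 : ℕ) - 2 - 2 := by
    simpa [one_dotProduct] using dotProduct_comp_inner_of_eq hi omegaZero_inner 1
  rw [sum_vegaVertex, hinner]
  simp only [omegaZero]
  omega

end Vega

section VegaInverse

variable {i : ℕ}

/-- The symmetric integer matrix `C` with `A C = I + 𝟙 ω₀₀ᵀ`, where `A` is the adjacency matrix
of `Υ_i`. -/
def vegaInv (i : ℕ) : Matrix (VegaVertex i) (VegaVertex i) ℤ
  | .x, .x | .y, .y => 1
  | .x, .y | .y, .x => -1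
  | .x, .a | .x, .b | .x, .c | .a, .x | .b, .x | .c, .x => 1
  | .y, .u | .y, .v | .y, .w | .u, .y | .v, .y | .w, .y => 1
  | .x, _ | _, .x | .y, _ | _, .y => 0
  | .inner j, .inner l =>
      if j = l then 1
      else if ((j : ℕ) = 0 ∧ (l : ℕ) = 2 * i - 1) ∨ ((l : ℕ) = 0 ∧ (j : ℕ) = 2 * i - 1) then -1
      else if ((j : ℤ) - (l : ℤ)).natAbs = i ∨ ((j : ℤ) - (l : ℤ)).natAbs = 2 * i - 1 then 1
      else 0
  | .inner j, .a | .inner j, .u | .a, .inner j | .u, .inner j =>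
      if (j : ℕ) = 2 * i - 1 then 0 else 1
  | .inner j, .b | .inner j, .v | .b, .inner j | .v, .inner j => if (j : ℕ) = 0 then 0 else 1
  | .inner j, .c | .inner j, .w | .c, .inner j | .w, .inner j =>
      if (j : ℕ) = 0 ∨ (j : ℕ) = 2 * i - 1 then 0 else 1
  | .a, .a | .b, .b | .u, .u | .v, .v => i
  | .c, .w | .w, .c => i - 2
  | _, _ => i - 1

theorem vegaInv_isSymm : (vegaInv i).IsSymm := by
  refine IsSymm.ext fun z t => ?_
  cases z <;> cases t <;> first | rfl | (simp only [vegaInv]; split_ifs <;> first | rfl | omega)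

theorem exists_add_sub_mod (hi : 2 ≤ i) (j : Fin (3 * i - 1)) : ∃ p q : Fin (3 * i - 1),
    ((p : ℕ) = j + i ∨ (p : ℕ) + (3 * i - 1) = j + i) ∧
    ((q : ℕ) + i = j ∨ (q : ℕ) + i = j + (3 * i - 1)) := by
  have := j.isLt
  refine ⟨⟨if (j : ℕ) + i < 3 * i - 1 then j + i else j + i - (3 * i - 1), by split_ifs <;> omega⟩,
    ⟨if i ≤ (j : ℕ) then j - i else j + (3 * i - 1) - i, by split_ifs <;> omega⟩, ?_, ?_⟩
  all_goals simp only; split_ifs <;> omega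

variable {j p q : Fin (3 * i - 1)}

theorem vegaInv_inner_comp_inner (hi : 2 ≤ i)
    (hp : (p : ℕ) = j + i ∨ (p : ℕ) + (3 * i - 1) = j + i)
    (hq : (q : ℕ) + i = j ∨ (q : ℕ) + i = j + (3 * i - 1)) :
    vegaInv i (.inner j) ∘ .inner = Pi.single j 1 +
      (if (j : ℕ) = 2 * i - 1 then (-1 : ℤ) else 1) • Pi.single p 1 +
      (if (j : ℕ) = 0 then (-1 : ℤ) else 1) • Pi.single q 1 := by
  ext l
  have := j.isLt
  have := l.isLt
  simp only [vegaInv, Function.comp_apply, Pi.add_apply, Pi.smul_apply, Pi.single_apply,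
    smul_eq_mul, Fin.ext_iff]
  split_ifs <;> omega

theorem adjMatrix_vega_mulVec_vegaInv_inner (hi : 2 ≤ i)
    (hp : (p : ℕ) = j + i ∨ (p : ℕ) + (3 * i - 1) = j + i)
    (hq : (q : ℕ) + i = j ∨ (q : ℕ) + i = j + (3 * i - 1)) (z : VegaVertex i) :
    ((vega i).adjMatrix ℤ *ᵥ vegaInv i (.inner j)) z =
      outerNbrSum (vegaInv i (.inner j)) z + (innerAdj z j +
        (if (j : ℕ) = 2 * i - 1 then -1 else 1) * innerAdj z p +
        (if (j : ℕ) = 0 then -1 else 1) * innerAdj z q) := by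
  simp only [adjMatrix_vega_mulVec, vegaInv_inner_comp_inner hi hp hq, dotProduct_add,
    dotProduct_smul, dotProduct_single_one, smul_eq_mul]

theorem innerAdj_inner_add_add (hi : 2 ≤ i)
    (hp : (p : ℕ) = j + i ∨ (p : ℕ) + (3 * i - 1) = j + i)
    (hq : (q : ℕ) + i = j ∨ (q : ℕ) + i = j + (3 * i - 1)) (l : Fin (3 * i - 1)) :
    innerAdj (.inner l) j + innerAdj (.inner l) p + innerAdj (.inner l) q =
      (if l = j then 1 else 0) + 1 := by
  have := j.isLt
  have := l.isLt
  have := p.isLt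
  have := q.isLt
  simp only [innerAdj, Fin.ext_iff]
  rcases hp with hp | hp <;> rcases hq with hq | hq <;> split_ifs <;> omega

theorem adjMatrix_vega_mulVec_vegaInv_inner_inner (hi : 2 ≤ i) (l j : Fin (3 * i - 1)) :
    ((vega i).adjMatrix ℤ *ᵥ vegaInv i (.inner j)) (.inner l) =
      (if l = j then 1 else 0) + omegaZero i (.inner j) := by
  obtain ⟨p, q, hp, hq⟩ := exists_add_sub_mod hi j
  have := j.isLt
  have := l.isLt
  have htriple := innerAdj_inner_add_add hi hp hq l
  rw [adjMatrix_vega_mulVec_vegaInv_inner hi hp hq]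
  generalize (if l = j then (1 : ℤ) else 0) = e at htriple ⊢
  simp only [outerNbrSum, vegaInv, omegaZero]
  by_cases hj0 : (j : ℕ) = 0
  · rw [show (q : ℕ) = 2 * i - 1 by omega, innerAdj_mid hi] at htriple ⊢
    simp only [hj0, show ¬ 0 = 2 * i - 1 by omega, if_true, if_false, true_or] at htriple ⊢
    split_ifs at htriple ⊢ <;> omega
  by_cases hj1 : (j : ℕ) = 2 * i - 1
  · rw [show (p : ℕ) = 0 by omega, innerAdj_zero hi] at htriple ⊢
    simp only [hj1, show ¬ 2 * i - 1 = 0 by omega, if_true, if_false, or_true] at htriple ⊢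
    split_ifs at htriple ⊢ <;> omega
  · simp only [hj0, hj1, or_self, if_false, one_mul, htriple]
    split_ifs <;> omega

theorem adjMatrix_vega_mulVec_vegaInv (hi : 2 ≤ i) (t z : VegaVertex i) :
    ((vega i).adjMatrix ℤ *ᵥ vegaInv i t) z = (if z = t then 1 else 0) + omegaZero i t := by
  cases t with
  | inner j =>
    cases z with
    | inner l => simpa using adjMatrix_vega_mulVec_vegaInv_inner_inner hi l j
    | _ =>
      obtain ⟨p, q, hp, hq⟩ := exists_add_sub_mod hi j
      have := j.isLt
      simp only [adjMatrix_vega_mulVec_vegaInv_inner hi hp hq, outerNbrSum, innerAdj, vegaInv,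
        omegaZero, reduceCtorEq, if_false]
      split_ifs <;> omega
  | x | y =>
    rw [adjMatrix_vega_mulVec_of_inner_eq (c := 0) (α := 0) (β := 0) hi fun j => by simp [vegaInv]]
    cases z <;> simp [outerNbrSum, vegaInv, omegaZero]
  | a | u =>
    rw [adjMatrix_vega_mulVec_of_inner_eq (c := 1) (α := 0) (β := 1) hi fun j => by
      simp only [vegaInv]; split_ifs <;> simp]
    cases z <;> simp only [outerNbrSum, innerDegree, innerAdj_zero hi, innerAdj_mid hi, vegaInv,
      omegaZero, reduceCtorEq, if_true, if_false] <;> (try split_ifs) <;> omega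
  | b | v =>
    rw [adjMatrix_vega_mulVec_of_inner_eq (c := 1) (α := 1) (β := 0) hi fun j => by
      simp only [vegaInv]; split_ifs <;> simp]
    cases z <;> simp only [outerNbrSum, innerDegree, innerAdj_zero hi, innerAdj_mid hi, vegaInv,
      omegaZero, reduceCtorEq, if_true, if_false] <;> (try split_ifs) <;> omega
  | c | w =>
    rw [adjMatrix_vega_mulVec_of_inner_eq (c := 1) (α := 1) (β := 1) hi fun j => by
      simp only [vegaInv]; split_ifs <;> omega]
    cases z <;> simp only [outerNbrSum, innerDegree, innerAdj_zero hi, innerAdj_mid hi, vegaInv,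
      omegaZero, reduceCtorEq, if_true, if_false] <;> (try split_ifs) <;> omega

theorem isWeightedInverse_vegaInv (hi : 2 ≤ i) :
    IsWeightedInverse ((vega i).adjMatrix ℤ) Set.univ (9 * i - 6) (omegaZero i) (vegaInv i) where
  isSymm_left := SimpleGraph.isSymm_adjMatrix _
  isSymm := vegaInv_isSymm
  weight_of_notMem z hz := absurd (Set.mem_univ z) hz
  apply_of_notMem z hz := absurd (Set.mem_univ z) hz
  sum_weight := by rw [sum_omegaZero hi]; ring
  mulVec_weight z _ := adjMatrix_vega_mulVec_omegaZero hi z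
  mul_apply z _ t := by
    rw [one_apply, ← adjMatrix_vega_mulVec_vegaInv hi, Matrix.mul_apply, mulVec, dotProduct]
    simp only [vegaInv_isSymm.apply]

end VegaInverse

section VegaDeletion

variable {i : ℕ}

theorem vegaInv_y : vegaInv i .y = f i := by
  ext t; cases t <;> rfl

theorem vegaInv_mid (hi : 2 ≤ i) {j : Fin (3 * i - 1)} (hj : (j : ℕ) = 2 * i - 1) :
    vegaInv i (.inner j) = g i := by
  ext t
  cases t with
  | inner l =>
    have := l.isLt
    simp only [vegaInv, g, hj, Fin.ext_iff, and_true]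
    split_ifs <;> omega
  | _ => simp [vegaInv, g, hj] <;> omega

theorem y_mem_vegaVerts {μ ν : Fin 2} : .y ∈ vegaVerts i μ ν ↔ μ ≠ 1 := by
  simp [vegaVerts]

theorem inner_mem_vegaVerts {μ ν : Fin 2} {j : Fin (3 * i - 1)} :
    .inner j ∈ vegaVerts i μ ν ↔ ¬ (ν = 1 ∧ (j : ℕ) = 2 * i - 1) := by
  simp [vegaVerts]

theorem g_mid (hi : 2 ≤ i) {j : Fin (3 * i - 1)} (hj : (j : ℕ) = 2 * i - 1) :
    g i (.inner j) = 1 := by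
  simp only [g, hj, or_true, if_true]
  split_ifs <;> omega

/-- The matrix `C - μ f fᵀ - ν g gᵀ`, which plays the role of `C = vegaInv i` for `Υ_i^{μν}`. -/
def vegaInvDel (i : ℕ) (μ ν : Fin 2) : Matrix (VegaVertex i) (VegaVertex i) ℤ :=
  vegaInv i - ((μ : ℕ) : ℤ) • vecMulVec (f i) (f i) - ((ν : ℕ) : ℤ) • vecMulVec (g i) (g i)

theorem vegaInvDel_apply (μ ν : Fin 2) (z t : VegaVertex i) : vegaInvDel i μ ν z t =
    vegaInv i z t - ((μ : ℕ) : ℤ) * (f i z * f i t) - ((ν : ℕ) : ℤ) * (g i z * g i t) :=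
  rfl

theorem isWeightedInverse_vegaInvDel_zero (hi : 2 ≤ i) (μ : Fin 2) :
    IsWeightedInverse ((vega i).adjMatrix ℤ) (vegaVerts i μ 0) (9 * i - 6 - (μ : ℕ)) (omega i μ 0)
      (vegaInvDel i μ 0) := by
  obtain rfl | rfl : μ = 0 ∨ μ = 1 := by omega
  · convert isWeightedInverse_vegaInv hi using 1
    · ext z; simp [vegaVerts]
    · simp
    · ext z; simp [omega]
    · simp [vegaInvDel]
  · convert (isWeightedInverse_vegaInv hi).erase (y := .y) (by omega) rfl rfl using 1
    · ext z; simp [vegaVerts]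
    · simp
    · ext z; simp [omega, vegaInv_y]
    · simp [vegaInvDel, vegaInv_y]

theorem isWeightedInverse_vegaInvDel (hi : 2 ≤ i) (μ ν : Fin 2) :
    IsWeightedInverse ((vega i).adjMatrix ℤ) (vegaVerts i μ ν) (9 * i - 6 - (μ : ℕ) - (ν : ℕ))
      (omega i μ ν) (vegaInvDel i μ ν) := by
  obtain rfl | rfl : ν = 0 ∨ ν = 1 := by omega
  · simpa using isWeightedInverse_vegaInvDel_zero hi μ
  let m : Fin (3 * i - 1) := ⟨2 * i - 1, by omega⟩
  have hrow : vegaInvDel i μ 0 (.inner m) = g i := by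
    ext t
    simp [vegaInvDel_apply, vegaInv_mid hi (j := m) rfl, f]
  have hweight : omega i μ 0 (.inner m) = 1 := by simp [omega, omegaZero, f, m]
  convert (isWeightedInverse_vegaInvDel_zero hi μ).erase (by omega) hweight
    ((congrFun hrow _).trans (g_mid hi rfl)) using 1
  · ext z
    cases z with
    | inner j => simp [inner_mem_vegaVerts, Fin.ext_iff, m]
    | _ => simp [vegaVerts]
  · simp
  · ext z; simp [omega, hrow]
  · rw [hrow]; simp [vegaInvDel]

end VegaDeletion

section VegaDomination

variable {i : ℕ} {μ ν : Fin 2} {z t : VegaVertex i}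

/-- The vertices `a, b, c, u, v, w` of the hexagon, on which the weights `ω_{μν}` are large. -/
def IsHex : VegaVertex i → Prop
  | .x | .y | .inner _ => False
  | _ => True

theorem IsHex.le_omega (hz : IsHex z) : 3 * (i : ℤ) - 4 ≤ omega i μ ν z := by
  have := μ.isLt
  have := ν.isLt
  cases z <;> simp only [IsHex, omega, omegaZero, f, g] at hz ⊢ <;> omega

theorem IsHex.one_lt_omega (hi : 2 ≤ i) (hz : IsHex z) : 1 < omega i μ ν z :=
  lt_of_lt_of_le (by omega) hz.le_omega

theorem omega_x : omega i μ ν .x = 1 + (μ : ℕ) := by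
  simp [omega, omegaZero, f, g]

theorem omega_y : omega i μ ν .y = 1 - (μ : ℕ) := by
  simp [omega, omegaZero, f, g]

theorem omega_pos (hi : 2 ≤ i) (hz : z ∈ vegaVerts i μ ν) : 0 < omega i μ ν z := by
  have := ν.isLt
  cases z with
  | x => rw [omega_x]; omega
  | y => rw [y_mem_vegaVerts] at hz; rw [omega_y]; omega
  | inner j =>
    rw [inner_mem_vegaVerts] at hz
    simp only [omega, omegaZero, f, g]
    split_ifs <;> omega
  | a | b | c | u | v | w => exact one_pos.trans (IsHex.one_lt_omega hi trivial)

theorem eq_of_omega_eq_one (hi : 2 ≤ i) (hz : z ∈ vegaVerts i μ ν) (hw : omega i μ ν z = 1) :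
    (μ = 0 ∧ (z = .x ∨ z = .y)) ∨
      (ν = 0 ∧ ∃ j : Fin (3 * i - 1), z = .inner j ∧ ((j : ℕ) = 0 ∨ (j : ℕ) = 2 * i - 1)) := by
  cases z with
  | x => rw [omega_x] at hw; exact .inl ⟨by omega, .inl rfl⟩
  | y => rw [omega_y] at hw; exact .inl ⟨by omega, .inr rfl⟩
  | inner j =>
    suffices ν = 0 ∧ ((j : ℕ) = 0 ∨ (j : ℕ) = 2 * i - 1) from .inr ⟨this.1, j, rfl, this.2⟩
    rw [inner_mem_vegaVerts] at hz
    simp only [omega, omegaZero, f, g] at hw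
    split_ifs at hw <;> omega
  | a | b | c | u | v | w => exact absurd hw (LT.lt.ne' (IsHex.one_lt_omega hi trivial))

theorem IsHex.vegaInvDel_le (hz : IsHex z) (ht : IsHex t) : vegaInvDel i μ ν z t ≤ i := by
  have hf : 0 ≤ f i z * f i t := by
    cases z <;> simp only [IsHex] at hz <;> cases t <;> simp only [IsHex] at ht <;> simp [f]
  have hg : 0 ≤ g i z * g i t := by
    cases z <;> simp only [IsHex] at hz <;> cases t <;> simp only [IsHex] at ht <;> simp [g]
  calc vegaInvDel i μ ν z t ≤ vegaInv i z t := by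
        have hμf : 0 ≤ ((μ : ℕ) : ℤ) * (f i z * f i t) := by positivity
        have hνg : 0 ≤ ((ν : ℕ) : ℤ) * (g i z * g i t) := by positivity
        rw [vegaInvDel_apply]
        omega
    _ ≤ i := by
        cases z <;> simp only [IsHex] at hz <;> cases t <;> simp only [IsHex] at ht <;>
          simp only [vegaInv] <;> omega

theorem IsHex.vegaInvDel_le_one (hz : IsHex z) (ht : ¬ IsHex t) : vegaInvDel i μ ν z t ≤ 1 := by
  have := μ.isLt
  have := ν.isLt
  cases t <;> simp only [IsHex, not_true_eq_false] at ht <;>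
    cases z <;> simp only [IsHex] at hz <;> simp only [vegaInvDel_apply, vegaInv, f, g] <;>
    (try split_ifs) <;> omega

theorem vegaInvDel_inner_inner_lt (hi : 2 ≤ i) {j l : Fin (3 * i - 1)}
    (hj : .inner j ∈ vegaVerts i μ ν) (hl : .inner l ∈ vegaVerts i μ ν)
    (hne : ¬ (j = l ∧ omega i μ ν (.inner j) = 1)) :
    vegaInvDel i μ ν (.inner j) (.inner l) <
      omega i μ ν (.inner j) * omega i μ ν (.inner l) := by
  rw [inner_mem_vegaVerts] at hj hl
  obtain rfl | rfl : ν = 0 ∨ ν = 1 := by omega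
  · simp only [vegaInvDel_apply, omega, vegaInv, omegaZero, f, g, Fin.coe_ofNat_eq_mod,
      Nat.zero_mod, Nat.cast_zero, zero_mul, mul_zero, sub_zero, Fin.ext_iff] at hne ⊢
    split_ifs at hne ⊢ <;> omega
  · rw [eq_self, true_and] at hj hl
    simp only [vegaInvDel_apply, omega, vegaInv, omegaZero, f, g, hj, hl, Fin.coe_ofNat_eq_mod,
      Nat.one_mod, Nat.cast_one, one_mul, mul_zero, sub_zero, Fin.ext_iff, or_false, and_false,
      if_false]
    split_ifs <;> omega

theorem vegaInvDel_lt_of_not_isHex (hi : 2 ≤ i) (hz : z ∈ vegaVerts i μ ν)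
    (ht : t ∈ vegaVerts i μ ν) (hzh : ¬ IsHex z) (hth : ¬ IsHex t)
    (hne : ¬ (z = t ∧ omega i μ ν z = 1)) :
    vegaInvDel i μ ν z t < omega i μ ν z * omega i μ ν t := by
  have hpos := mul_pos (omega_pos hi hz) (omega_pos hi ht)
  have := μ.isLt
  cases z <;> simp only [IsHex, not_true_eq_false] at hzh <;>
    cases t <;> simp only [IsHex, not_true_eq_false] at hth
  case inner.inner j l => exact vegaInvDel_inner_inner_lt hi hz ht (by simpa using hne)
  case x.inner | y.inner | inner.x | inner.y => simpa [vegaInvDel_apply, vegaInv, f, g] using hpos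
  all_goals
    obtain rfl | rfl : μ = 0 ∨ μ = 1 := by omega
    all_goals simp_all [vegaVerts, vegaInvDel_apply, vegaInv, omega, omegaZero, f, g]

theorem vegaInvDel_lt (hi : 2 ≤ i) (hz : z ∈ vegaVerts i μ ν) (ht : t ∈ vegaVerts i μ ν)
    (hne : ¬ (z = t ∧ omega i μ ν z = 1)) :
    vegaInvDel i μ ν z t < omega i μ ν z * omega i μ ν t := by
  have hz_pos := omega_pos hi hz
  have ht_pos := omega_pos hi ht
  by_cases hzh : IsHex z <;> by_cases hth : IsHex t
  · calc vegaInvDel i μ ν z t ≤ i := hzh.vegaInvDel_le hth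
      _ < 2 * (3 * i - 4) := by omega
      _ ≤ omega i μ ν z * omega i μ ν t :=
        mul_le_mul (hzh.one_lt_omega hi) hth.le_omega (by omega) hz_pos.le
  · calc vegaInvDel i μ ν z t ≤ 1 := hzh.vegaInvDel_le_one hth
      _ < omega i μ ν z * omega i μ ν t := one_lt_mul_of_lt_of_le (hzh.one_lt_omega hi) ht_pos
  · calc vegaInvDel i μ ν z t = vegaInvDel i μ ν t z :=
          (isWeightedInverse_vegaInvDel hi μ ν).isSymm.apply t z
      _ ≤ 1 := hth.vegaInvDel_le_one hzh
      _ < omega i μ ν z * omega i μ ν t := one_lt_mul_of_le_of_lt hz_pos (hth.one_lt_omega hi)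
  · exact vegaInvDel_lt_of_not_isHex hi hz ht hzh hth hne

theorem vegaInvDel_eq_vegaInv_of_omega_eq_one (hi : 2 ≤ i) (hz : z ∈ vegaVerts i μ ν)
    (hw : omega i μ ν z = 1) : vegaInvDel i μ ν z = vegaInv i z := by
  ext t
  rcases eq_of_omega_eq_one hi hz hw with ⟨rfl, rfl | rfl⟩ | ⟨rfl, j, rfl, -⟩ <;>
    simp [vegaInvDel_apply, f, g]

theorem vegaInvDel_self_of_omega_eq_one (hi : 2 ≤ i) (hz : z ∈ vegaVerts i μ ν)
    (hw : omega i μ ν z = 1) : vegaInvDel i μ ν z z = 1 := by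
  rw [vegaInvDel_eq_vegaInv_of_omega_eq_one hi hz hw]
  rcases eq_of_omega_eq_one hi hz hw with ⟨-, rfl | rfl⟩ | ⟨-, j, rfl, -⟩ <;> simp [vegaInv]

theorem vegaInvDel_le (hi : 2 ≤ i) (hz : z ∈ vegaVerts i μ ν) (ht : t ∈ vegaVerts i μ ν) :
    vegaInvDel i μ ν z t ≤ omega i μ ν z * omega i μ ν t := by
  by_cases hne : z = t ∧ omega i μ ν z = 1
  · obtain ⟨rfl, hw⟩ := hne
    rw [vegaInvDel_self_of_omega_eq_one hi hz hw, hw, one_mul]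
  · exact (vegaInvDel_lt hi hz ht hne).le

end VegaDomination

section VegaAutomorphisms

variable {i : ℕ} {μ ν : Fin 2}

/-- An adjacency-preserving involution, as an automorphism. -/
def isoOfInvolutive {α : Type*} {F : SimpleGraph α} {σ : α → α} (hσ : Function.Involutive σ)
    (hadj : ∀ {z t}, F.Adj z t → F.Adj (σ z) (σ t)) : F ≃g F where
  toEquiv := hσ.toPerm σ
  map_rel_iff' {z t} := ⟨fun h => by simpa only [hσ.coe_toPerm, hσ z, hσ t] using hadj h, hadj⟩

/-- The underlying map of `vegaSwap`. -/
def swapFun : VegaVertex i → VegaVertex i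
  | .x => .y | .y => .x | .a => .u | .u => .a | .b => .v | .v => .b | .c => .w | .w => .c
  | .inner j => .inner j

theorem swapFun_involutive : Function.Involutive (swapFun (i := i)) := by
  intro z; cases z <;> rfl

theorem vega_adj_swapFun {z t : VegaVertex i} (h : (vega i).Adj z t) :
    (vega i).Adj (swapFun z) (swapFun t) := by
  cases z <;> cases t <;> simp_all [vega_adj, vegaRel, swapFun]

/-- The reflection of the cyclically arranged vertices of `Γ_i` that exchanges `v_0` and
`v_{2i-1}`. -/
def reflectFin (j : Fin (3 * i - 1)) : Fin (3 * i - 1) :=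
  ⟨if (j : ℕ) ≤ 2 * i - 1 then 2 * i - 1 - j else 5 * i - 2 - j, by
    have := j.isLt; split_ifs <;> omega⟩

/-- The underlying map of `vegaReflect`. -/
def reflectFun : VegaVertex i → VegaVertex i
  | .x => .x | .y => .y | .a => .b | .b => .a | .u => .v | .v => .u | .c => .c | .w => .w
  | .inner j => .inner (reflectFin j)

theorem reflectFun_involutive : Function.Involutive (reflectFun (i := i)) := by
  intro z
  cases z with
  | inner j =>
    have := j.isLt
    simp only [reflectFun, reflectFin, VegaVertex.inner.injEq, Fin.ext_iff]
    split_ifs <;> omega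
  | _ => rfl

theorem vega_adj_reflectFun (hi : 2 ≤ i) {z t : VegaVertex i} (h : (vega i).Adj z t) :
    (vega i).Adj (reflectFun z) (reflectFun t) := by
  cases z with
  | inner j =>
    have := j.isLt
    cases t with
    | inner l =>
      have := l.isLt
      simp only [reflectFun, reflectFin, vega_adj_inner] at h ⊢
      split_ifs <;> omega
    | _ =>
      simp only [vega_adj, vegaRel, reflectFun, reflectFin, ne_eq, reduceCtorEq, not_false_eq_true,
        true_and, or_false, false_or] at h ⊢ <;> split_ifs <;> omega
  | _ =>
    cases t with
    | inner l =>
      have := l.isLt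
      simp only [vega_adj, vegaRel, reflectFun, reflectFin, ne_eq, reduceCtorEq, not_false_eq_true,
        true_and, or_false] at h ⊢ <;> split_ifs <;> omega
    | _ => simp [vega_adj, vegaRel, reflectFun] at h ⊢

/-- The automorphism of `Υ_i` exchanging `x, a, b, c` with `y, u, v, w`. -/
def vegaSwap (i : ℕ) : vega i ≃g vega i :=
  isoOfInvolutive swapFun_involutive vega_adj_swapFun

/-- The automorphism of `Υ_i` that reflects `Γ_i` and exchanges `a, u` with `b, v`. -/
def vegaReflect (hi : 2 ≤ i) : vega i ≃g vega i :=
  isoOfInvolutive reflectFun_involutive (vega_adj_reflectFun hi)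

theorem bijOn_vegaSwap : Set.BijOn (vegaSwap i) (vegaVerts i 0 ν) (vegaVerts i 0 ν) :=
  (vegaSwap i).toEquiv.bijOn fun z => by
    change swapFun z ∈ _ ↔ _
    cases z <;> simp [vegaVerts, swapFun]

theorem bijOn_vegaReflect (hi : 2 ≤ i) :
    Set.BijOn (vegaReflect hi) (vegaVerts i μ 0) (vegaVerts i μ 0) :=
  (vegaReflect hi).toEquiv.bijOn fun z => by
    change reflectFun z ∈ _ ↔ _
    cases z <;> simp [vegaVerts, reflectFun]

theorem omega_comp_vegaSwap : omega i 0 ν ∘ vegaSwap i = omega i 0 ν := by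
  ext z
  change omega i 0 ν (swapFun z) = _
  cases z <;> simp [omega, omegaZero, g, swapFun]

theorem omega_comp_vegaReflect (hi : 2 ≤ i) : omega i μ 0 ∘ vegaReflect hi = omega i μ 0 := by
  ext z
  change omega i μ 0 (reflectFun z) = _
  cases z with
  | inner j =>
    have := j.isLt
    simp only [omega, omegaZero, f, reflectFun, reflectFin, Fin.coe_ofNat_eq_mod, Nat.zero_mod,
      Nat.cast_zero, zero_mul]
    split_ifs <;> omega
  | _ => simp [omega, omegaZero, f, reflectFun]

theorem vegaInv_x : vegaInv i .x = f i ∘ vegaSwap i := by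
  ext t; cases t <;> rfl

theorem vegaInv_zero (hi : 2 ≤ i) {j : Fin (3 * i - 1)} (hj : (j : ℕ) = 0) :
    vegaInv i (.inner j) = g i ∘ vegaReflect hi := by
  ext t
  change _ = g i (reflectFun t)
  cases t with
  | inner l =>
    have := l.isLt
    simp only [vegaInv, g, reflectFun, reflectFin, hj, Fin.ext_iff, true_and]
    split_ifs <;> omega
  | _ => simp [vegaInv, g, reflectFun, hj] <;> omega

theorem exists_automorphism_of_omega_eq_one (hi : 2 ≤ i) {z : VegaVertex i}
    (hz : z ∈ vegaVerts i μ ν) (hw : omega i μ ν z = 1) :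
    ∃ σ : vega i ≃g vega i, Set.BijOn σ (vegaVerts i μ ν) (vegaVerts i μ ν) ∧
      omega i μ ν ∘ σ = omega i μ ν ∧
      ((μ = 0 ∧ vegaInvDel i μ ν z = f i ∘ σ) ∨ (ν = 0 ∧ vegaInvDel i μ ν z = g i ∘ σ)) := by
  rw [vegaInvDel_eq_vegaInv_of_omega_eq_one hi hz hw]
  rcases eq_of_omega_eq_one hi hz hw with ⟨rfl, rfl | rfl⟩ | ⟨rfl, j, rfl, hj | hj⟩
  · exact ⟨vegaSwap i, bijOn_vegaSwap, omega_comp_vegaSwap, .inl ⟨rfl, vegaInv_x⟩⟩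
  · exact ⟨.refl, Set.bijOn_id _, rfl, .inl ⟨rfl, vegaInv_y⟩⟩
  · exact ⟨vegaReflect hi, bijOn_vegaReflect hi, omega_comp_vegaReflect hi,
      .inr ⟨rfl, vegaInv_zero hi hj⟩⟩
  · exact ⟨.refl, Set.bijOn_id _, rfl, .inr ⟨rfl, vegaInv_mid hi hj⟩⟩

end VegaAutomorphisms

section Parameters

variable {k n s : ℕ}

theorem cast_lam : (lam k n s : ℚ) = (3 * k - 1) * s - k * n := by
  simp [lam]

theorem two_mul_edgeBound :
    2 * edgeBound k n s = n * s - lam k n s * (3 * s - n - lam k n s) := by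
  rw [edgeBound, cast_lam]
  ring

theorem lam_eq_zero_iff (hk : 1 ≤ k) : lam k n s = 0 ↔ (s : ℚ) = k * n / (3 * k - 1) := by
  have : (1 : ℚ) ≤ k := mod_cast hk
  rw [← Int.cast_eq_zero (α := ℚ), cast_lam, eq_div_iff (by linarith), sub_eq_zero, mul_comm]

theorem lam_pos_iff (hk : 1 ≤ k) : 0 < lam k n s ↔ (k : ℚ) * n / (3 * k - 1) < s := by
  have : (1 : ℚ) ≤ k := mod_cast hk
  rw [← Int.cast_pos (R := ℚ), cast_lam, div_lt_iff₀ (by linarith), sub_pos, mul_comm (s : ℚ)]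

theorem lam_le_iff (hk : 2 ≤ k) :
    lam k n s ≤ 3 * s - n ↔ (s : ℚ) ≤ (k - 1) * n / (3 * k - 4) := by
  have : (2 : ℚ) ≤ k := mod_cast hk
  rw [← Int.cast_le (R := ℚ), cast_lam, le_div_iff₀ (by linarith)]
  push_cast
  constructor <;> intro h <;> linarith

theorem le_three_mul_of_lam_eq_zero (hk : 1 ≤ k) (hl : lam k n s = 0) : n ≤ 3 * s := by
  have hkn : (k : ℤ) * n ≤ k * (3 * s) := by
    rw [lam] at hl
    linarith [Int.natCast_nonneg s]
  exact_mod_cast le_of_mul_le_mul_left hkn (by omega)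

end Parameters

section Extremal

variable {V : Type*} {H : SimpleGraph V} {i k n s : ℕ} {μ ν : Fin 2} {h : vegaVerts i μ ν → ℕ}

/-- The class sizes of the blow-ups of `Υ_i^{μν}` in the family `ℋ^n_k(s)`. -/
def ExtremalWeights (i k n s : ℕ) (μ ν : Fin 2) (h : vegaVerts i μ ν → ℕ) : Prop :=
  ((s : ℚ) = k * n / (3 * k - 1) ∧ ∀ z, (h z : ℤ) = (3 * (s : ℤ) - n) * omega i μ ν z) ∨
    ((k : ℚ) * n / (3 * k - 1) < s ∧ (s : ℚ) ≤ (k - 1) * n / (3 * k - 4) ∧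
      ((μ = 0 ∧ ∀ z, (h z : ℤ) = (3 * (s : ℤ) - n) * omega i μ ν z - lam k n s * f i z) ∨
        (ν = 0 ∧ ∀ z, (h z : ℤ) = (3 * (s : ℤ) - n) * omega i μ ν z - lam k n s * g i z)))

theorem ExtremalWeights.exists_family (hi : 2 ≤ i) (hk : k = 9 * i - (6 + (μ : ℕ) + (ν : ℕ)))
    (e : H ≃g blowUp (vegaDel i μ ν) h) (hh : ExtremalWeights i k n s μ ν h) :
    ∃ (W : Type) (G : SimpleGraph W), ExtremalFamily n k s W G ∧ Nonempty (H ≃g G) := by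
  rcases hh with ⟨hs, hh⟩ | ⟨hs, hs', ⟨rfl, hh⟩ | ⟨rfl, hh⟩⟩
  · refine ⟨_, _, .balanced i μ ν hi hk hs, ⟨e.trans (blowUpBlowUp fun z => ?_)⟩⟩
    have hk1 : 1 ≤ k := by omega
    zify [le_three_mul_of_lam_eq_zero hk1 ((lam_eq_zero_iff hk1).2 hs)]
    rw [hh z, Int.toNat_of_nonneg (omega_pos hi z.2).le, mul_comm]
  · exact ⟨_, _, .alongF i ν hi (by simpa using hk) hs hs' h hh, ⟨e⟩⟩
  · exact ⟨_, _, .alongG i μ hi (by simpa using hk) hs hs' h hh, ⟨e⟩⟩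

theorem weights_of_card_edgeFinset_eq [Fintype V] [Fintype H.edgeSet] (hi : 2 ≤ i)
    (hk : k = 9 * i - (6 + (μ : ℕ) + (ν : ℕ))) (e : H ≃g blowUp (vegaDel i μ ν) h)
    (hn : Fintype.card V = n) (hα : H.indepNum ≤ s)
    (he : (H.edgeFinset.card : ℚ) = edgeBound k n s) :
    (lam k n s = 0 ∧ ∀ z, (h z : ℤ) = (3 * (s : ℤ) - n) * omega i μ ν z) ∨
      (0 < lam k n s ∧ lam k n s ≤ 3 * (s : ℤ) - n ∧
        ∃ z ∈ vegaVerts i μ ν, omega i μ ν z = 1 ∧ ∀ t : vegaVerts i μ ν,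
          (h t : ℤ) = (3 * (s : ℤ) - n) * omega i μ ν t - lam k n s * vegaInvDel i μ ν z t) := by
  obtain ⟨c, rfl, hch, hc⟩ := exists_eq_comap_of_iso_blowUp_induce e
  have hk' : 9 * (i : ℤ) - 6 - (μ : ℕ) - (ν : ℕ) = k := by omega
  have hE : classSize c ⬝ᵥ (vega i).adjMatrix ℤ *ᵥ classSize c =
      n * s - lam k n s * (3 * s - n - lam k n s) := by
    rw [← two_mul_card_edgeFinset_comap]
    exact_mod_cast he ▸ two_mul_edgeBound (k := k) (n := n) (s := s)
  have hle : ∀ z ∈ vegaVerts i μ ν, ∀ t ∈ vegaVerts i μ ν,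
      vegaInvDel i μ ν z t ≤ omega i μ ν z * omega i μ ν t :=
    fun z hz t ht => vegaInvDel_le hi hz ht
  have heq : ∀ z ∈ vegaVerts i μ ν, ∀ t ∈ vegaVerts i μ ν,
      vegaInvDel i μ ν z t = omega i μ ν z * omega i μ ν t → z = t ∧ omega i μ ν z = 1 :=
    fun z hz t ht h => by_contra fun hne => (vegaInvDel_lt hi hz ht hne).ne h
  have hnbr (z : VegaVertex i) : ((vega i).adjMatrix ℤ *ᵥ classSize c) z ≤ s :=
    (adjMatrix_mulVec_classSize_le_indepNum _ c (vega_cliqueFree_three hi) z).trans (mod_cast hα)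
  have hsum : ∑ z, classSize c z = (n : ℤ) := by rw [sum_classSize, hn]
  rcases (isWeightedInverse_vegaInvDel hi μ ν).eq_of_dotProduct_mulVec_eq (by omega) hle heq
    (fun z => Int.natCast_nonneg _) hc (fun z _ => hnbr z) hsum (by rw [hk', lam]) hE with
    ⟨hl, hh⟩ | ⟨hl, hle, z, hz, hw, hh⟩
  · exact .inl ⟨hl, fun z => (hch z).symm.trans (congrFun hh z)⟩
  · exact .inr ⟨hl, hle, z, hz, hw, fun t => (hch t).symm.trans (congrFun hh t)⟩

theorem exists_extremalWeights [Fintype V] [Fintype H.edgeSet] (hi : 2 ≤ i)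
    (hk : k = 9 * i - (6 + (μ : ℕ) + (ν : ℕ))) (e : H ≃g blowUp (vegaDel i μ ν) h)
    (hn : Fintype.card V = n) (hα : H.indepNum ≤ s)
    (he : (H.edgeFinset.card : ℚ) = edgeBound k n s) :
    ∃ h' : vegaVerts i μ ν → ℕ, Nonempty (H ≃g blowUp (vegaDel i μ ν) h') ∧
      ExtremalWeights i k n s μ ν h' := by
  rcases weights_of_card_edgeFinset_eq hi hk e hn hα he with
    ⟨hl, hh⟩ | ⟨hl, hle, z, hz, hw, hh⟩
  · exact ⟨h, ⟨e⟩, .inl ⟨(lam_eq_zero_iff (by omega)).1 hl, hh⟩⟩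
  have hs := (lam_pos_iff (by omega)).1 hl
  have hs' := (lam_le_iff (by omega)).1 hle
  obtain ⟨σ, hσ, hωσ, ⟨hμ, hrow⟩ | ⟨hν, hrow⟩⟩ := exists_automorphism_of_omega_eq_one hi hz hw
  · obtain ⟨h', e', hh'⟩ := exists_iso_blowUp_induce_of_comp σ hσ e
      (w := fun t => (3 * (s : ℤ) - n) * omega i μ ν t - lam k n s * f i t) fun t => by
        rw [hh, hrow, ← congrFun hωσ]; rfl
    exact ⟨h', e', .inr ⟨hs, hs', .inl ⟨hμ, hh'⟩⟩⟩
  · obtain ⟨h', e', hh'⟩ := exists_iso_blowUp_induce_of_comp σ hσ e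
      (w := fun t => (3 * (s : ℤ) - n) * omega i μ ν t - lam k n s * g i t) fun t => by
        rw [hh, hrow, ← congrFun hωσ]; rfl
    exact ⟨h', e', .inr ⟨hs, hs', .inr ⟨hν, hh'⟩⟩⟩

end Extremal

end VegaExtremal

theorem lemma4p4 {V : Type*} [Fintype V] (i k n s : ℕ) (μ ν : Fin 2) (hi : 2 ≤ i)
    (hk : k = 9 * i - (6 + (μ : ℕ) + (ν : ℕ))) (hs : 1 ≤ s) (hsn : s ≤ n)
    (H : SimpleGraph V) [Fintype H.edgeSet]
    (hH : VegaExtremal.IsBlowUp H (VegaExtremal.vegaDel i μ ν))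
    (hn : Fintype.card V = n) (hα : H.indepNum ≤ s)
    (he : (H.edgeFinset.card : ℚ) = VegaExtremal.edgeBound k n s) :
    (∃ (W : Type) (G : SimpleGraph W), VegaExtremal.ExtremalFamily n k s W G ∧ Nonempty (H ≃g G)) ∧
    -- the class sizes, with the given `i`, `μ`, `ν`
    ∃ h : VegaExtremal.vegaVerts i μ ν → ℕ, Nonempty (H ≃g VegaExtremal.blowUp (VegaExtremal.vegaDel i μ ν) h) ∧
      (((s : ℚ) = k * n / (3 * k - 1) ∧
          ∀ z, (h z : ℤ) = (3 * (s : ℤ) - n) * VegaExtremal.omega i μ ν z) ∨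
        ((k : ℚ) * n / (3 * k - 1) < s ∧ (s : ℚ) ≤ (k - 1) * n / (3 * k - 4) ∧
          ((μ = 0 ∧
              ∀ z, (h z : ℤ) = (3 * (s : ℤ) - n) * VegaExtremal.omega i μ ν z - VegaExtremal.lam k n s * VegaExtremal.f i z) ∨
            (ν = 0 ∧
              ∀ z, (h z : ℤ) = (3 * (s : ℤ) - n) * VegaExtremal.omega i μ ν z - VegaExtremal.lam k n s * VegaExtremal.g i z)))) := by
  obtain ⟨h₀, ⟨e₀⟩⟩ := hH
  obtain ⟨h, ⟨e⟩, hh⟩ := VegaExtremal.exists_extremalWeights hi hk e₀ hn hα he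
  exact ⟨hh.exists_family hi hk e, h, ⟨e⟩, hh⟩
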